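/- Let $\mathcal H$ be a finite-dimensional real or complex inner product space. For subspaces $\mathcal X,\mathcal Y\subseteq\mathcal H$ with orthogonal projectors $P_{\mathcal X},P_{\mathcal Y}$ on $\mathcal H$, let $m=\min\{\dim\mathcal X,\dim\mathcal Y\}$ and let $\Theta(\mathcal X,\mathcal Y)=[\theta_1,\dots,\theta_m]$ be the vector of principal angles, defined by $\theta_i\in[0,\pi/2]$ and $\cos\theta_i=s_i(P_{\mathcal X}P_{\mathcal Y})$, where $s_1\ge s_2\ge\cdots$ are the singular values in non-increasing order. Functions of vectors are taken entrywise. For real vectors $x,y$, made of equal length $N$ by appending zeros to the shorter one, write $x\prec_w y$ if $\sum_{i=1}^k x_i^\downarrow\le\sum_{i=1}^k y_i^\downarrow$ for $k=1,\dots,N$, where $x^\downarrow$ is $x$ rearranged in non-increasing order. Theorem. Let $\mathcal X,\mathcal Y,\mathcal Z$ be subspaces of $\mathcal H$ with $\dim\mathcal X=\dim\mathcal Y$. Then $$|\cos^2\Theta(\mathcal X,\mathcal Z)-\cos^2\Theta(\mathcal Y,\mathcal Z)|=|\sin^2\Theta(\mathcal X,\mathcal Z)-\sin^2\Theta(\mathcal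 Y,\mathcal Z)|\prec_w\sin\Theta(\mathcal X,\mathcal Y).$$ -/

import Mathlib

noncomputable section

/-- The vector `x↓`: the entries of `x` rearranged in non-increasing order. -/
def sortDesc {n : ℕ} (x : Fin n → ℝ) : Fin n → ℝ :=
  x ∘ Tuple.sort (fun i => -x i)

/-- Append zeros to `x` so that it has length `N` (used only with `n ≤ N`). -/
def padZero {n : ℕ} (N : ℕ) (x : Fin n → ℝ) : Fin N → ℝ :=
  fun i => if h : (i : ℕ) < n then x ⟨i, h⟩ else 0

/-- Weak (sub)majorization `x ≺_w y`: after zeros are appended to the shorter vector, for every `k`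
the sum of the `k` largest entries of `x` is at most the sum of the `k` largest entries of `y`. -/
def WeaklyMajorizedBy {m n : ℕ} (x : Fin m → ℝ) (y : Fin n → ℝ) : Prop :=
  ∀ k : ℕ, k ≤ max m n →
    ∑ i : Fin (max m n) with i.val < k, sortDesc (padZero (max m n) x) i ≤
      ∑ i : Fin (max m n) with i.val < k, sortDesc (padZero (max m n) y) i

/-- The vector `Θ(X, Y)` of principal angles, of length `m = min (dim X) (dim Y)`: the `i`-th angle
lies in `[0, π/2]` and its cosine is the `i`-th largest singular value of `P_X P_Y`, where `P_X` and
`P_Y` are the orthogonal projectors of the whole space onto `X` and `Y`. The angles are therefore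
in non-decreasing order. -/
def principalAngles {𝕜 : Type*} [RCLike 𝕜] {H : Type*} [NormedAddCommGroup H]
    [InnerProductSpace 𝕜 H] [FiniteDimensional 𝕜 H] (X Y : Submodule 𝕜 H) :
    Fin (min (Module.finrank 𝕜 X) (Module.finrank 𝕜 Y)) → ℝ :=
  fun i => Real.arccos
    (((X.starProjection ∘L Y.starProjection : H →L[𝕜] H) : H →ₗ[𝕜] H).singularValues i)

end

/-! For nonnegative `y`, the sum of the `k` largest entries is the minimum over `t ≥ 0` of `k * t +
∑ max (y i - t) 0`. So it suffices to bound, for each `t ≥ 0` and each index set `J`, the sum over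
`J` of the absolute differences of squared cosines by `|J| t + ∑ (sin θ_i - t)₊`
(`sum_abs_cosSq_sub_le`).

The positive eigenvalues of `P_X - P_Y` are supplied by the nonzero sines between `X` and `Y`, so
cutting its spectrum at `t` gives `P_X ≤ P_Y + t + R` with `R ≥ 0` and `tr R ≤ ∑ (sin θ_i - t)₊`.
Conjugating by `P_Z` and applying a Lidskii-type inequality bounds sums of signed differences by
`|J| t + tr (R P_Z)`.

Indices with a negative difference are handled by `Zᗮ`: squared cosines against `Zᗮ` are one minus
those against `Z`, in reverse order, so the sign flips. The same `R` serves both, and `tr (R P_Z) +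
tr (R P_Zᗮ) = tr R`, so no factor 2 is lost. -/

/-! ### Eigenvalue inequalities of Weyl and Lidskii type. -/

theorem OrthonormalBasis.re_inner_apply_eq_sum {𝕜 : Type*} [RCLike 𝕜] {H : Type*}
    [NormedAddCommGroup H] [InnerProductSpace 𝕜 H] {ι : Type*} [Fintype ι]
    (b : OrthonormalBasis ι 𝕜 H) {T : H →ₗ[𝕜] H} {μ : ι → ℝ}
    (hT : ∀ i, T (b i) = (μ i : 𝕜) • b i) (v : H) :
    RCLike.re (inner 𝕜 v (T v)) = ∑ i, μ i * ‖inner 𝕜 (b i) v‖ ^ 2 := by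
  have hTv : T v = ∑ i, inner 𝕜 (b i) v • ((μ i : 𝕜) • b i) := by
    conv_lhs => rw [← b.sum_repr' v, map_sum]
    simp [hT]
  rw [hTv, inner_sum, map_sum]
  refine Finset.sum_congr rfl fun i _ => ?_
  rw [inner_smul_right, inner_smul_right, ← inner_conj_symm v (b i), mul_left_comm,
    RCLike.mul_conj]
  norm_cast

/-- Weyl's monotonicity principle, for eigenbases ordered by decreasing eigenvalue. -/
theorem eigenvalue_le_add_of_forall_re_inner_le {𝕜 : Type*} [RCLike 𝕜] {H : Type*}
    [NormedAddCommGroup H] [InnerProductSpace 𝕜 H] {N : ℕ}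
    (b c : OrthonormalBasis (Fin N) 𝕜 H) {T S : H →ₗ[𝕜] H} {μ ν : Fin N → ℝ} {t : ℝ}
    (hT : ∀ i, T (b i) = (μ i : 𝕜) • b i) (hS : ∀ i, S (c i) = (ν i : 𝕜) • c i)
    (hμ : Antitone μ) (hν : Antitone ν)
    (h : ∀ v, RCLike.re (inner 𝕜 v (T v)) ≤ RCLike.re (inner 𝕜 v (S v)) + t * ‖v‖ ^ 2)
    (i : Fin N) : μ i ≤ ν i + t := by
  have : FiniteDimensional 𝕜 H := b.toBasis.finiteDimensional_of_finite
  -- The `N - 1` conditions `v ⟂ c j` for `j < i` and `v ⟂ b j` for `j > i`, padded by a zero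
  -- coordinate at `i`. This square system is not surjective, so it has a nonzero solution.
  let L : H →ₗ[𝕜] (Fin N → 𝕜) := LinearMap.pi fun j =>
    if j < i then (innerSL 𝕜 (c j)).toLinearMap else
      if i < j then (innerSL 𝕜 (b j)).toLinearMap else 0
  have hL : ¬ Function.Injective L := by
    rw [LinearMap.injective_iff_surjective_of_finrank_eq_finrank
      (by simp [Module.finrank_eq_card_basis b.toBasis])]
    intro hs
    obtain ⟨v, hv⟩ := hs (Pi.single i 1)
    have := congrFun hv i
    simp [L] at this
  rw [← LinearMap.ker_eq_bot, Submodule.eq_bot_iff] at hL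
  push Not at hL
  obtain ⟨v, hv, hv0⟩ := hL
  have hv' : ∀ j, L v j = 0 := fun j => congrFun hv j
  have hc : ∀ j, j < i → inner 𝕜 (c j) v = 0 := fun j hj => by simpa [L, hj] using hv' j
  have hb : ∀ j, i < j → inner 𝕜 (b j) v = 0 := fun j hj => by
    simpa [L, hj, hj.not_gt] using hv' j
  have h1 : μ i * ‖v‖ ^ 2 ≤ RCLike.re (inner 𝕜 v (T v)) := by
    rw [b.re_inner_apply_eq_sum hT, ← b.sum_sq_norm_inner_right v, Finset.mul_sum]
    refine Finset.sum_le_sum fun j _ => ?_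
    rcases lt_or_ge i j with hj | hj
    · simp [hb j hj]
    · exact mul_le_mul_of_nonneg_right (hμ hj) (by positivity)
  have h2 : RCLike.re (inner 𝕜 v (S v)) ≤ ν i * ‖v‖ ^ 2 := by
    rw [c.re_inner_apply_eq_sum hS, ← c.sum_sq_norm_inner_right v, Finset.mul_sum]
    refine Finset.sum_le_sum fun j _ => ?_
    rcases lt_or_ge j i with hj | hj
    · simp [hc j hj]
    · exact mul_le_mul_of_nonneg_right (hν hj) (by positivity)
  have h3 := h v
  have h4 : 0 < ‖v‖ ^ 2 := by positivity
  nlinarith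

namespace LinearMap.IsSymmetric

variable {𝕜 : Type*} [RCLike 𝕜] {H : Type*} [NormedAddCommGroup H] [InnerProductSpace 𝕜 H]
  [FiniteDimensional 𝕜 H] {T S R : H →ₗ[𝕜] H}

/-- Weyl's principle with `S = T` and `t = 0`, used in both directions between the two eigenbases.
-/
theorem eigenvalues_eq_of_orthonormalBasis {N : ℕ} (hT : T.IsSymmetric)
    (hN : Module.finrank 𝕜 H = N) (b : OrthonormalBasis (Fin N) 𝕜 H) {μ : Fin N → ℝ}
    (hb : ∀ i, T (b i) = (μ i : 𝕜) • b i) (hμ : Antitone μ) : hT.eigenvalues hN = μ := by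
  ext i
  apply le_antisymm
  · simpa using eigenvalue_le_add_of_forall_re_inner_le (t := 0) (hT.eigenvectorBasis hN) b
      (hT.apply_eigenvectorBasis hN) hb (hT.eigenvalues_antitone hN) hμ (by simp) i
  · simpa using eigenvalue_le_add_of_forall_re_inner_le (t := 0) b (hT.eigenvectorBasis hN)
      hb (hT.apply_eigenvectorBasis hN) hμ (hT.eigenvalues_antitone hN) (by simp) i

/-- A form of Lidskii's inequality: the perturbation is bounded by a multiple of the identity plus
a positive operator. -/
theorem sum_eigenvalues_sub_le (hT : T.IsSymmetric) (hS : S.IsSymmetric) (hR : R.IsPositive)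
    {t : ℝ} (h : ∀ v, RCLike.re (inner 𝕜 v (T v)) ≤
      RCLike.re (inner 𝕜 v (S v)) + t * ‖v‖ ^ 2 + RCLike.re (inner 𝕜 v (R v)))
    (J : Finset (Fin (Module.finrank 𝕜 H))) :
    ∑ i ∈ J, (hT.eigenvalues rfl i - hS.eigenvalues rfl i) ≤
      J.card * t + RCLike.re (LinearMap.trace 𝕜 H R) := by
  have hSR : (S + R).IsSymmetric := hS.add hR.isSymmetric
  have h1 : ∀ i, hT.eigenvalues rfl i ≤ hSR.eigenvalues rfl i + t :=
    eigenvalue_le_add_of_forall_re_inner_le (hT.eigenvectorBasis rfl) (hSR.eigenvectorBasis rfl)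
      (hT.apply_eigenvectorBasis rfl) (hSR.apply_eigenvectorBasis rfl)
      (hT.eigenvalues_antitone rfl) (hSR.eigenvalues_antitone rfl) fun v => by
        have := h v
        simp only [LinearMap.add_apply, inner_add_right, map_add]
        linarith
  have h2 : ∀ i, hS.eigenvalues rfl i ≤ hSR.eigenvalues rfl i := fun i => by
    simpa using eigenvalue_le_add_of_forall_re_inner_le (t := 0)
      (hS.eigenvectorBasis rfl) (hSR.eigenvectorBasis rfl)
      (hS.apply_eigenvectorBasis rfl) (hSR.apply_eigenvectorBasis rfl)
      (hS.eigenvalues_antitone rfl) (hSR.eigenvalues_antitone rfl) (fun v => by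
        have := hR.re_inner_nonneg_right v
        simp only [LinearMap.add_apply, inner_add_right, map_add]
        linarith) i
  calc ∑ i ∈ J, (hT.eigenvalues rfl i - hS.eigenvalues rfl i)
      ≤ ∑ i ∈ J, (t + (hSR.eigenvalues rfl i - hS.eigenvalues rfl i)) :=
        Finset.sum_le_sum fun i _ => by linarith [h1 i]
    _ = J.card * t + ∑ i ∈ J, (hSR.eigenvalues rfl i - hS.eigenvalues rfl i) := by
        rw [Finset.sum_add_distrib, Finset.sum_const, nsmul_eq_mul]
    -- Since `R ≥ 0`, every term is nonnegative; enlarging `J` to all indices turns the sum into a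
    -- trace.
    _ ≤ J.card * t + ∑ i, (hSR.eigenvalues rfl i - hS.eigenvalues rfl i) := by
        gcongr
        · intro i _ _
          exact sub_nonneg.2 (h2 i)
        · exact J.subset_univ
    _ = J.card * t + RCLike.re (LinearMap.trace 𝕜 H R) := by
        rw [Finset.sum_sub_distrib, ← hSR.re_trace_eq_sum_eigenvalues,
          ← hS.re_trace_eq_sum_eigenvalues, map_add, map_add, add_sub_cancel_left]

end LinearMap.IsSymmetric

/-! ### Squared cosines as singular values and as eigenvalues of compressions. -/

/-- `T T*` and `T* T` have the same characteristic polynomial. -/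
theorem LinearMap.singularValues_adjoint {𝕜 : Type*} [RCLike 𝕜] {H : Type*}
    [NormedAddCommGroup H] [InnerProductSpace 𝕜 H] [FiniteDimensional 𝕜 H] (T : H →ₗ[𝕜] H) :
    (LinearMap.adjoint T).singularValues = T.singularValues := by
  have hchar : (LinearMap.adjoint (LinearMap.adjoint T) ∘ₗ LinearMap.adjoint T).charpoly =
      (LinearMap.adjoint T ∘ₗ T).charpoly := by
    let b := (stdOrthonormalBasis 𝕜 H).toBasis
    rw [LinearMap.adjoint_adjoint, ← LinearMap.charpoly_toMatrix _ b,
      ← LinearMap.charpoly_toMatrix (LinearMap.adjoint T ∘ₗ T) b, LinearMap.toMatrix_comp b b b,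
      LinearMap.toMatrix_comp b b b, Matrix.charpoly_mul_comm]
  have heig := ((LinearMap.adjoint T).isSymmetric_adjoint_comp_self.eigenvalues_eq_eigenvalues_iff
    rfl T.isSymmetric_adjoint_comp_self rfl).2 hchar
  ext i
  rcases lt_or_ge i (Module.finrank 𝕜 H) with hi | hi
  · rw [LinearMap.singularValues_of_lt _ rfl hi, LinearMap.singularValues_of_lt _ rfl hi, heig]
  · rw [LinearMap.singularValues_of_finrank_le _ hi, LinearMap.singularValues_of_finrank_le _ hi]

namespace Submodule

variable {𝕜 : Type*} [RCLike 𝕜] {H : Type*} [NormedAddCommGroup H] [InnerProductSpace 𝕜 H]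
  [FiniteDimensional 𝕜 H]

/-- The squared singular values of `P_X P_Y`; those of index less than `min (dim X) (dim Y)` are
the squared cosines of the principal angles between `X` and `Y`. -/
noncomputable def cosSq (X Y : Submodule 𝕜 H) (i : ℕ) : ℝ :=
  ((X.starProjection ∘L Y.starProjection : H →L[𝕜] H) : H →ₗ[𝕜] H).singularValues i ^ 2

theorem adjoint_starProjection_comp (X Y : Submodule 𝕜 H) :
    LinearMap.adjoint ((X.starProjection ∘L Y.starProjection : H →L[𝕜] H) : H →ₗ[𝕜] H) =
      ((Y.starProjection ∘L X.starProjection : H →L[𝕜] H) : H →ₗ[𝕜] H) := by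
  symm
  rw [LinearMap.eq_adjoint_iff]
  intro x y
  simp only [ContinuousLinearMap.coe_coe, ContinuousLinearMap.comp_apply]
  rw [inner_starProjection_left_eq_right, inner_starProjection_left_eq_right]

theorem adjoint_starProjection_comp_comp_apply (X Y : Submodule 𝕜 H) (v : H) :
    (LinearMap.adjoint ((X.starProjection ∘L Y.starProjection : H →L[𝕜] H) : H →ₗ[𝕜] H) ∘ₗ
      ((X.starProjection ∘L Y.starProjection : H →L[𝕜] H) : H →ₗ[𝕜] H)) v =
      Y.starProjection (X.starProjection (Y.starProjection v)) := by
  rw [adjoint_starProjection_comp]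
  simp [starProjection_eq_self_iff.2 (starProjection_apply_mem X (Y.starProjection v))]

theorem re_inner_starProjection_self (X : Submodule 𝕜 H) (v : H) :
    RCLike.re (inner 𝕜 v (X.starProjection v)) = ‖X.starProjection v‖ ^ 2 := by
  rw [← inner_self_eq_norm_sq (𝕜 := 𝕜), inner_starProjection_left_eq_right,
    starProjection_eq_self_iff.2 (starProjection_apply_mem _ _)]

theorem cosSq_comm (X Y : Submodule 𝕜 H) (i : ℕ) : cosSq X Y i = cosSq Y X i := by
  rw [cosSq, cosSq, ← adjoint_starProjection_comp X Y, LinearMap.singularValues_adjoint]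

theorem cosSq_nonneg (X Y : Submodule 𝕜 H) (i : ℕ) : 0 ≤ cosSq X Y i := sq_nonneg _

theorem cosSq_antitone (X Y : Submodule 𝕜 H) : Antitone (cosSq X Y) := fun _ _ hij =>
  pow_le_pow_left₀ (LinearMap.singularValues_nonneg _ _) (LinearMap.singularValues_antitone _ hij) 2

theorem cosSq_eq_eigenvalues (X Y : Submodule 𝕜 H) {i : ℕ} (hi : i < Module.finrank 𝕜 H) :
    cosSq X Y i = ((X.starProjection ∘L Y.starProjection : H →L[𝕜] H) :
      H →ₗ[𝕜] H).isSymmetric_adjoint_comp_self.eigenvalues rfl ⟨i, hi⟩ :=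
  LinearMap.sq_singularValues_of_lt _ rfl hi

theorem cosSq_eq_zero_of_finrank_le (X Y : Submodule 𝕜 H) {i : ℕ} (hi : Module.finrank 𝕜 X ≤ i) :
    cosSq X Y i = 0 := by
  have : Module.finrank 𝕜 (LinearMap.range
      ((X.starProjection ∘L Y.starProjection : H →L[𝕜] H) : H →ₗ[𝕜] H)) ≤ Module.finrank 𝕜 X := by
    apply Submodule.finrank_mono
    rintro _ ⟨v, rfl⟩
    exact starProjection_apply_mem _ _
  rw [cosSq, (LinearMap.singularValues_eq_zero_iff_le_finrank_range _).2 (this.trans hi)]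
  simp

/-- An orthonormal eigenbasis of the compression of `P_Z` to `X` computes `cosSq X Z`. -/
theorem cosSq_eq_of_orthonormalBasis (X Z : Submodule 𝕜 H)
    (x : OrthonormalBasis (Fin (Module.finrank 𝕜 X)) 𝕜 X) {τ : Fin (Module.finrank 𝕜 X) → ℝ}
    (hx : ∀ i, X.starProjection (Z.starProjection (x i : H)) = (τ i : 𝕜) • (x i : H))
    (hτ : Antitone τ) (hτ0 : ∀ i, 0 ≤ τ i) (i : Fin (Module.finrank 𝕜 X)) :
    cosSq X Z i = τ i := by
  have hle : Module.finrank 𝕜 X ≤ Module.finrank 𝕜 H := Submodule.finrank_le X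
  let v : Fin (Module.finrank 𝕜 H) → H := fun j =>
    if h : (j : ℕ) < Module.finrank 𝕜 X then x ⟨j, h⟩ else 0
  let μ : Fin (Module.finrank 𝕜 H) → ℝ := fun j =>
    if h : (j : ℕ) < Module.finrank 𝕜 X then τ ⟨j, h⟩ else 0
  let s : Set (Fin (Module.finrank 𝕜 H)) := {j | (j : ℕ) < Module.finrank 𝕜 X}
  have hv : Orthonormal 𝕜 (s.domRestrict v) := by
    have h1 : Orthonormal 𝕜 fun i => (x i : H) := x.orthonormal.comp_linearIsometry X.subtypeₗᵢ
    have h2 := h1.comp (fun j : s => (⟨j.1, j.2⟩ : Fin (Module.finrank 𝕜 X)))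
      (fun a b hab => by
        apply Subtype.ext; apply Fin.ext; simpa using hab)
    convert h2 using 1
    ext j
    have := j.2
    simp only [s, Set.mem_ofPred_eq] at this
    simp [v, this]
  obtain ⟨b, hb⟩ := hv.exists_orthonormalBasis_extension_of_card_eq (by simp)
  have hbX : ∀ j : Fin (Module.finrank 𝕜 H), ¬ (j : ℕ) < Module.finrank 𝕜 X → X.starProjection (b j) = 0 := by
    intro j hj
    rw [starProjection_apply_eq_zero_iff, mem_orthogonal]
    intro u hu
    have hsum := x.sum_repr' ⟨u, hu⟩
    have hu' : u = ∑ i, inner 𝕜 (x i) (⟨u, hu⟩ : X) • (x i : H) := by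
      simpa using (congrArg (Subtype.val) hsum).symm
    rw [hu', sum_inner]
    refine Finset.sum_eq_zero fun i _ => ?_
    have hi : (x i : H) = b ⟨i, i.2.trans_le hle⟩ := by
      rw [hb _ (by simp [s])]; simp [v]
    rw [inner_smul_left, hi, b.inner_eq_zero (by
      intro h
      apply hj
      rw [← h]; simp), mul_zero]
  have hi := i.2.trans_le hle
  -- After the swap the operator is `P_X P_Z P_X`, which `b` diagonalizes.
  rw [cosSq_comm, cosSq_eq_eigenvalues _ _ hi,
    LinearMap.IsSymmetric.eigenvalues_eq_of_orthonormalBasis _ rfl b (μ := μ)]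
  · simp [μ]
  · intro j
    rw [adjoint_starProjection_comp_comp_apply]
    by_cases hj : (j : ℕ) < Module.finrank 𝕜 X
    · rw [hb j hj]
      simp only [v, μ, hj, dif_pos]
      rw [starProjection_eq_self_iff.2 (x _).2, hx]
    · rw [hbX j hj]
      simp [μ, hj]
  · intro j k hjk
    have hjk' : (j : ℕ) ≤ k := hjk
    by_cases hk : (k : ℕ) < Module.finrank 𝕜 X
    · simp only [μ, hk, hjk'.trans_lt hk, dif_pos]
      exact hτ (by simpa using hjk')
    · simp only [μ, hk, dif_neg, not_false_eq_true]
      split_ifs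
      · exact hτ0 _
      · rfl

/-- The spectral theorem for the compression of `P_Z` to `X`; the basis consists of principal
vectors. -/
theorem exists_orthonormalBasis_starProjection_eq_cosSq_smul (X Z : Submodule 𝕜 H) :
    ∃ x : OrthonormalBasis (Fin (Module.finrank 𝕜 X)) 𝕜 X,
      ∀ i, X.starProjection (Z.starProjection (x i : H)) = (cosSq X Z i : 𝕜) • (x i : H) := by
  let T : X →ₗ[𝕜] X := (X.orthogonalProjectionOnto ∘L Z.starProjection ∘L X.subtypeL : X →L[𝕜] X)
  have hTapp : ∀ u : X, (T u : H) = X.starProjection (Z.starProjection (u : H)) := fun u => rfl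
  have hin : ∀ u v : X, inner 𝕜 u (T v) = inner 𝕜 (u : H) (Z.starProjection (v : H)) := by
    intro u v
    rw [coe_inner, hTapp, ← inner_starProjection_left_eq_right,
      starProjection_eq_self_iff.2 u.2]
  have hT : T.IsPositive := by
    refine ⟨fun u v => ?_, fun u => ?_⟩
    · rw [hin, ← inner_starProjection_left_eq_right, ← inner_conj_symm, hin, inner_conj_symm]
    · rw [← inner_conj_symm, RCLike.conj_re, hin, re_inner_starProjection_self]
      positivity
  have hx : ∀ i, X.starProjection (Z.starProjection (hT.isSymmetric.eigenvectorBasis rfl i : H)) =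
      (hT.isSymmetric.eigenvalues rfl i : 𝕜) • (hT.isSymmetric.eigenvectorBasis rfl i : H) := by
    intro i
    rw [← hTapp, hT.isSymmetric.apply_eigenvectorBasis]
    rfl
  refine ⟨hT.isSymmetric.eigenvectorBasis rfl, fun i => ?_⟩
  rw [hx, cosSq_eq_of_orthonormalBasis X Z _ hx (hT.isSymmetric.eigenvalues_antitone rfl)
    (hT.nonneg_eigenvalues rfl)]

theorem cosSq_eq_norm_sq (X Z : Submodule 𝕜 H)
    (x : OrthonormalBasis (Fin (Module.finrank 𝕜 X)) 𝕜 X)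
    (hx : ∀ i, X.starProjection (Z.starProjection (x i : H)) = (cosSq X Z i : 𝕜) • (x i : H))
    (i : Fin (Module.finrank 𝕜 X)) : cosSq X Z i = ‖Z.starProjection (x i : H)‖ ^ 2 := by
  have hn : ‖(x i : H)‖ = 1 := x.norm_eq_one i
  rw [← re_inner_starProjection_self, ← starProjection_eq_self_iff.2 (x i).2,
    inner_starProjection_left_eq_right, starProjection_eq_self_iff.2 (x i).2, hx,
    inner_smul_right, RCLike.re_ofReal_mul, inner_self_eq_norm_sq, hn]
  simp

theorem cosSq_le_one (X Z : Submodule 𝕜 H) (i : ℕ) : cosSq X Z i ≤ 1 := by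
  rcases lt_or_ge i (Module.finrank 𝕜 X) with hi | hi
  · obtain ⟨x, hx⟩ := exists_orthonormalBasis_starProjection_eq_cosSq_smul X Z
    have hn : ‖(x ⟨i, hi⟩ : H)‖ = 1 := x.norm_eq_one _
    have h := cosSq_eq_norm_sq X Z x hx ⟨i, hi⟩
    simp only at h
    rw [h]
    exact pow_le_one₀ (norm_nonneg _) ((Z.norm_starProjection_apply_le _).trans_eq hn)
  · rw [cosSq_eq_zero_of_finrank_le X Z hi]
    exact zero_le_one

/-- On `X`, the compression of `P_Zᗮ` is the identity minus that of `P_Z`, so the same eigenbasis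
works with its order reversed. -/
theorem cosSq_orthogonal (X Z : Submodule 𝕜 H) {i : ℕ} (hi : i < Module.finrank 𝕜 X) :
    cosSq X Zᗮ i = 1 - cosSq X Z (Module.finrank 𝕜 X - 1 - i) := by
  obtain ⟨x, hx⟩ := exists_orthonormalBasis_starProjection_eq_cosSq_smul X Z
  have := cosSq_eq_of_orthonormalBasis X Zᗮ (x.reindex Fin.revPerm)
    (τ := fun i => 1 - cosSq X Z (Fin.rev i)) (fun j => by
      rw [starProjection_orthogonal']
      simp only [OrthonormalBasis.reindex_apply, Fin.revPerm_symm, Fin.revPerm_apply,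
        _root_.sub_apply, one_apply_eq_self, map_sub, hx]
      rw [starProjection_eq_self_iff.2 (x _).2]
      push_cast
      rw [sub_smul, one_smul])
    (fun j k hjk => sub_le_sub_left (cosSq_antitone X Z (by
      have : (j : ℕ) ≤ k := hjk
      simp only [Fin.val_rev]; omega)) 1)
    (fun j => sub_nonneg.2 (cosSq_le_one X Z _)) ⟨i, hi⟩
  simp only [Fin.val_rev] at this
  rw [this]
  congr 2
  omega

/-! ### Operator bounds for a difference of projectors. -/

/-- Conjugation by `P_Z` preserves the operator inequality, and Lidskii then applies with `P_Z R
P_Z`. Keeping `tr (R P_Z)` rather than `tr R` lets the bounds for `Z` and `Zᗮ` be added. -/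
theorem sum_cosSq_sub_le {X Y : Submodule 𝕜 H} (Z : Submodule 𝕜 H) {R : H →ₗ[𝕜] H}
    (hR : R.IsPositive) {t : ℝ} (ht : 0 ≤ t)
    (h : ∀ v, ‖X.starProjection v‖ ^ 2 ≤
      ‖Y.starProjection v‖ ^ 2 + t * ‖v‖ ^ 2 + RCLike.re (inner 𝕜 v (R v)))
    {J : Finset ℕ} (hJ : ∀ i ∈ J, i < Module.finrank 𝕜 H) :
    ∑ i ∈ J, (cosSq X Z i - cosSq Y Z i) ≤
      J.card * t + RCLike.re (LinearMap.trace 𝕜 H (R * (Z.starProjection : H →ₗ[𝕜] H))) := by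
  have hRZ : (LinearMap.adjoint (Z.starProjection : H →ₗ[𝕜] H) ∘ₗ R ∘ₗ
      (Z.starProjection : H →ₗ[𝕜] H)).IsPositive := hR.adjoint_conj _
  have hadj : LinearMap.adjoint (Z.starProjection : H →ₗ[𝕜] H) =
      (Z.starProjection : H →ₗ[𝕜] H) := by
    symm
    rw [LinearMap.eq_adjoint_iff]
    exact fun x y => inner_starProjection_left_eq_right _ _ _
  have htr : LinearMap.trace 𝕜 H (LinearMap.adjoint (Z.starProjection : H →ₗ[𝕜] H) ∘ₗ R ∘ₗ
      (Z.starProjection : H →ₗ[𝕜] H)) =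
      LinearMap.trace 𝕜 H (R * (Z.starProjection : H →ₗ[𝕜] H)) := by
    rw [hadj, LinearMap.trace_comp_comm']
    congr 1
    ext v
    simp [starProjection_eq_self_iff.2 (starProjection_apply_mem Z v)]
  have hquad : ∀ (W : Submodule 𝕜 H) (v : H), RCLike.re (inner 𝕜 v
      ((LinearMap.adjoint ((W.starProjection ∘L Z.starProjection : H →L[𝕜] H) : H →ₗ[𝕜] H) ∘ₗ
      ((W.starProjection ∘L Z.starProjection : H →L[𝕜] H) : H →ₗ[𝕜] H)) v)) =
      ‖W.starProjection (Z.starProjection v)‖ ^ 2 := by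
    intro W v
    rw [LinearMap.comp_apply, LinearMap.adjoint_inner_right, inner_self_eq_norm_sq]
    rfl
  have key := LinearMap.IsSymmetric.sum_eigenvalues_sub_le
    ((X.starProjection ∘L Z.starProjection : H →L[𝕜] H) :
      H →ₗ[𝕜] H).isSymmetric_adjoint_comp_self
    ((Y.starProjection ∘L Z.starProjection : H →L[𝕜] H) :
      H →ₗ[𝕜] H).isSymmetric_adjoint_comp_self hRZ (t := t) (fun v => by
      rw [hquad, hquad, LinearMap.comp_apply, LinearMap.adjoint_inner_right]
      have h1 := h (Z.starProjection v)
      have h2 : t * ‖Z.starProjection v‖ ^ 2 ≤ t * ‖v‖ ^ 2 := by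
        gcongr
        exact Z.norm_starProjection_apply_le v
      simp only [LinearMap.comp_apply, ContinuousLinearMap.coe_coe]
      linarith) (J.attachFin hJ)
  rw [htr, Finset.card_attachFin] at key
  refine le_trans (le_of_eq ?_) key
  conv_lhs => rw [← Finset.map_valEmbedding_attachFin hJ, Finset.sum_map]
  refine Finset.sum_congr rfl fun i _ => ?_
  simp only [Fin.valEmbedding_apply]
  rw [cosSq_eq_eigenvalues X Z i.2, cosSq_eq_eigenvalues Y Z i.2]

/-- `P_X - P_Y` is bounded by `t` plus a positive operator, whose trace is that of the positive part
of `sin Θ(X, Y) - t`. -/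
theorem exists_isPositive_norm_sq_starProjection_le (X Y : Submodule 𝕜 H) {t : ℝ} (ht : 0 ≤ t) :
    ∃ R : H →ₗ[𝕜] H, R.IsPositive ∧
      (∀ v, ‖X.starProjection v‖ ^ 2 ≤
        ‖Y.starProjection v‖ ^ 2 + t * ‖v‖ ^ 2 + RCLike.re (inner 𝕜 v (R v))) ∧
      RCLike.re (LinearMap.trace 𝕜 H R) ≤
        ∑ i : Fin (Module.finrank 𝕜 X), max (√(1 - cosSq X Y i) - t) 0 := by
  classical
  obtain ⟨x, hx⟩ := exists_orthonormalBasis_starProjection_eq_cosSq_smul X Y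
  let s : Fin (Module.finrank 𝕜 X) → ℝ := fun i => √(1 - cosSq X Y i)
  have hs0 : ∀ i, 0 ≤ s i := fun i => Real.sqrt_nonneg _
  have hs2 : ∀ i : Fin (Module.finrank 𝕜 X), cosSq X Y i = 1 - s i ^ 2 := fun i => by
    rw [Real.sq_sqrt (sub_nonneg.2 (cosSq_le_one X Y i))]; ring
  have hxx : ∀ i j, inner 𝕜 (x i : H) (x j : H) = if i = j then 1 else 0 := fun i j => by
    rw [← coe_inner]; exact orthonormal_iff_ite.1 x.orthonormal i j
  have hxP : ∀ i, X.starProjection (x i : H) = x i := fun i =>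
    starProjection_eq_self_iff.2 (x i).2
  have hPP : ∀ v, Y.starProjection (Y.starProjection v) = Y.starProjection v := fun v =>
    starProjection_eq_self_iff.2 (starProjection_apply_mem Y v)
  have hxYx : ∀ i j, inner 𝕜 (x i : H) (Y.starProjection (x j : H)) =
      if i = j then ((1 - s i ^ 2 : ℝ) : 𝕜) else 0 := fun i j => by
    rw [← hxP i, inner_starProjection_left_eq_right, hx, inner_smul_right, hxx, hs2]
    split_ifs with h
    · rw [h, mul_one]
    · rw [mul_zero]
  let D : H →ₗ[𝕜] H := (X.starProjection - Y.starProjection : H →L[𝕜] H)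
  have hDapp : ∀ v, D v = X.starProjection v - Y.starProjection v := fun v => rfl
  have hD : D.IsSymmetric := fun u v => by
    rw [hDapp, hDapp, inner_sub_left, inner_sub_right, inner_starProjection_left_eq_right,
      inner_starProjection_left_eq_right]
  have hDx : ∀ i, D (x i) = (x i : H) - Y.starProjection (x i : H) := fun i => by
    rw [hDapp, hxP]
  have hD2 : ∀ i, D (D (x i)) = ((s i ^ 2 : ℝ) : 𝕜) • (x i : H) := fun i => by
    rw [hDx, hDapp, map_sub, map_sub, hPP, hxP, hx, hs2]
    push_cast
    rw [sub_smul, one_smul]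
    abel
  -- As `D² x_i = s_i² x_i`, the vector `(D + s_i) x_i` is killed by `D - s_i`. It vanishes when
  -- `s_i = 0`, so only the indices in `I` are normalized below.
  let V : Fin (Module.finrank 𝕜 X) → H := fun i => D (x i) + (s i : 𝕜) • (x i : H)
  have hDV : ∀ i, D (V i) = (s i : 𝕜) • V i := fun i => by
    simp only [V]
    rw [map_add, map_smul, hD2, smul_add, smul_smul, add_comm]
    push_cast
    rw [sq]
  have hVV : ∀ i j, inner 𝕜 (V i) (V j) =
      if i = j then ((2 * s i ^ 2 * (1 + s i) : ℝ) : 𝕜) else 0 := by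
    intro i j
    have hxDx : inner 𝕜 (x i : H) (D (x j)) = if i = j then ((s i ^ 2 : ℝ) : 𝕜) else 0 := by
      rw [hDx, inner_sub_right, hxx, hxYx]
      split_ifs
      · push_cast; ring
      · simp
    have hDD : inner 𝕜 (D (x i)) (D (x j)) = if i = j then ((s i ^ 2 : ℝ) : 𝕜) else 0 := by
      rw [hD, hD2, inner_smul_right, hxx]
      split_ifs with h
      · rw [h, mul_one]
      · rw [mul_zero]
    simp only [V]
    rw [inner_add_left, inner_add_right, inner_add_right, hDD, inner_smul_right, hD,
      inner_smul_left, inner_smul_left, inner_smul_right, hxDx, hxx]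
    split_ifs with h
    · subst h
      simp only [RCLike.conj_ofReal]
      push_cast
      ring
    · simp
  let I := {i : Fin (Module.finrank 𝕜 X) // 0 < s i}
  let d : I → ℝ := fun i => √(2 * s i ^ 2 * (1 + s i))
  have hd : ∀ i, 0 < d i := fun i => by
    have := i.2
    exact Real.sqrt_pos.2 (by positivity)
  let u : I → H := fun i => ((d i)⁻¹ : 𝕜) • V i
  have hVu : ∀ i : I, V i = (d i : 𝕜) • u i := fun i => by
    have : (d i : 𝕜) ≠ 0 := RCLike.ofReal_ne_zero.2 (hd i).ne'
    simp only [u]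
    rw [smul_smul, mul_inv_cancel₀ this, one_smul]
  have hu : Orthonormal 𝕜 u := by
    rw [orthonormal_iff_ite]
    intro i j
    simp only [u]
    rw [inner_smul_left, inner_smul_right, hVV]
    by_cases h : i = j
    · subst h
      have h1 : d i ^ 2 = 2 * s i ^ 2 * (1 + s i) := by
        have := i.2
        exact Real.sq_sqrt (by positivity)
      simp only [if_true, ← h1, map_inv₀, RCLike.conj_ofReal]
      have : (d i : 𝕜) ≠ 0 := RCLike.ofReal_ne_zero.2 (hd i).ne'
      push_cast
      field_simp
    · have h' : (i : Fin (Module.finrank 𝕜 X)) ≠ j := fun h' => h (Subtype.ext h')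
      simp [h, h']
  have hDu : ∀ i : I, D (u i) = (s i : 𝕜) • u i := fun i => by
    simp only [u]
    rw [map_smul, hDV, smul_comm]
  -- `D ≤ 0` on the orthogonal complement of the `u i`: `w ⟂ V i` reads `⟨x_i, P_Y w⟩ = (1 + s_i)
  -- ⟨x_i, w⟩`, so `‖P_X w‖ ≤ ‖P_X P_Y w‖ ≤ ‖P_Y w‖`.
  have hneg : ∀ w, (∀ i, inner 𝕜 (u i) w = 0) →
      ‖X.starProjection w‖ ^ 2 ≤ ‖Y.starProjection w‖ ^ 2 := by
    intro w hw
    have hVw : ∀ i, inner 𝕜 (V i) w = 0 := by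
      intro i
      by_cases hi : 0 < s i
      · rw [hVu ⟨i, hi⟩, inner_smul_left, hw, mul_zero]
      · have hi0 : s i = 0 := le_antisymm (not_lt.1 hi) (hs0 i)
        have : V i = 0 := by
          rw [← inner_self_eq_zero (𝕜 := 𝕜), hVV]
          simp [hi0]
        rw [this, inner_zero_left]
    have hcoef : ∀ i, inner 𝕜 (x i : H) (X.starProjection (Y.starProjection w)) =
        ((1 + s i : ℝ) : 𝕜) * inner 𝕜 (x i : H) (X.starProjection w) := by
      intro i
      have h1 := hVw i
      simp only [V] at h1
      rw [hDx, inner_add_left, inner_sub_left, inner_smul_left, RCLike.conj_ofReal,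
        inner_starProjection_left_eq_right] at h1
      rw [← X.inner_starProjection_left_eq_right, ← X.inner_starProjection_left_eq_right, hxP]
      push_cast
      linear_combination -h1
    have hnorm : ∀ w, ‖X.starProjection w‖ ^ 2 =
        ∑ i, ‖inner 𝕜 (x i : H) (X.starProjection w)‖ ^ 2 := by
      intro w
      exact (x.sum_sq_norm_inner_right
        ⟨X.starProjection w, starProjection_apply_mem X w⟩).symm
    calc ‖X.starProjection w‖ ^ 2 ≤ ‖X.starProjection (Y.starProjection w)‖ ^ 2 := by
          rw [hnorm, hnorm]
          refine Finset.sum_le_sum fun i _ => ?_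
          rw [hcoef, norm_mul, RCLike.norm_of_nonneg (by linarith [hs0 i])]
          gcongr
          exact le_mul_of_one_le_left (norm_nonneg _) (by linarith [hs0 i])
      _ ≤ ‖Y.starProjection w‖ ^ 2 := by
          gcongr
          exact norm_starProjection_apply_le _ _
  have hre : ∀ w, RCLike.re (inner 𝕜 w (D w)) =
      ‖X.starProjection w‖ ^ 2 - ‖Y.starProjection w‖ ^ 2 := fun w => by
    rw [hDapp, inner_sub_right, map_sub, re_inner_starProjection_self,
      re_inner_starProjection_self]
  let r : I → ℝ := fun i => max (s i - t) 0
  let R : H →ₗ[𝕜] H := ∑ i, (r i : 𝕜) •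
    ((InnerProductSpace.rankOne 𝕜 (u i) (u i) : H →L[𝕜] H) : H →ₗ[𝕜] H)
  have hRin : ∀ v, RCLike.re (inner 𝕜 v (R v)) = ∑ i, r i * ‖inner 𝕜 (u i) v‖ ^ 2 := by
    intro v
    simp only [R, LinearMap.sum_apply, inner_sum, map_sum]
    refine Finset.sum_congr rfl fun i _ => ?_
    simp only [LinearMap.smul_apply, ContinuousLinearMap.coe_coe,
      InnerProductSpace.rankOne_apply]
    rw [inner_smul_right, inner_smul_right, ← inner_conj_symm v (u i), RCLike.mul_conj]
    norm_cast
  refine ⟨R, ?_, fun v => ?_, ?_⟩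
  · refine LinearMap.isPositive_sum _ fun i _ => LinearMap.IsPositive.smul_of_nonneg ?_ ?_
    · exact (ContinuousLinearMap.isPositive_toLinearMap_iff _).2
        (InnerProductSpace.isPositive_rankOne_self _)
    · exact_mod_cast le_max_right _ _
  -- `p` is the projection of `v` to the span of the `u i`. This span is `D`-invariant, so the form
  -- of `D` splits over `p` and `v - p`, and the second part is nonpositive by `hneg`.
  · let p : H := ∑ i, inner 𝕜 (u i) v • u i
    have hup : ∀ i, inner 𝕜 (u i) p = inner 𝕜 (u i) v := fun i => by
      simp only [p]
      exact hu.inner_right_fintype _ i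
    have huw : ∀ i, inner 𝕜 (u i) (v - p) = 0 := fun i => by
      rw [inner_sub_right, hup, sub_self]
    have hDp : D p = ∑ i : I, inner 𝕜 (u i) v • ((s i : 𝕜) • u i) := by
      simp only [p, map_sum, map_smul, hDu]
    have hwp : inner 𝕜 (v - p) (D p) = 0 := by
      rw [hDp, inner_sum]
      refine Finset.sum_eq_zero fun i _ => ?_
      rw [inner_smul_right, inner_smul_right, ← inner_conj_symm (v - p), huw]
      simp
    have hpw : inner 𝕜 p (D (v - p)) = 0 := by
      rw [← hD, ← inner_conj_symm, hwp, map_zero]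
    have hpp : RCLike.re (inner 𝕜 p (D p)) = ∑ i : I, s i * ‖inner 𝕜 (u i) v‖ ^ 2 := by
      rw [hDp, inner_sum, map_sum]
      refine Finset.sum_congr rfl fun i _ => ?_
      rw [inner_smul_right, inner_smul_right, ← inner_conj_symm p (u i), hup, mul_left_comm,
        RCLike.mul_conj]
      norm_cast
    have hsplit : RCLike.re (inner 𝕜 v (D v)) =
        RCLike.re (inner 𝕜 p (D p)) + RCLike.re (inner 𝕜 (v - p) (D (v - p))) := by
      conv_lhs => rw [← add_sub_cancel p v]
      rw [map_add, inner_add_left, inner_add_right, inner_add_right, hwp, hpw]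
      simp
    have h1 := hneg (v - p) huw
    have h2 : ∑ i : I, ‖inner 𝕜 (u i) v‖ ^ 2 ≤ ‖v‖ ^ 2 := hu.sum_inner_products_le (x := v)
    have h3 : ∑ i : I, s i * ‖inner 𝕜 (u i) v‖ ^ 2 ≤
        ∑ i : I, (t * ‖inner 𝕜 (u i) v‖ ^ 2 + r i * ‖inner 𝕜 (u i) v‖ ^ 2) := by
      refine Finset.sum_le_sum fun i _ => ?_
      rw [← add_mul]
      gcongr
      have := le_max_left (s i - t) 0
      simp only [r]
      linarith
    rw [Finset.sum_add_distrib, ← Finset.mul_sum] at h3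
    have h4 := mul_le_mul_of_nonneg_left h2 ht
    rw [hpp, hre, hre] at hsplit
    rw [hRin]
    linarith
  · have htr : LinearMap.trace 𝕜 H R = ((∑ i, r i : ℝ) : 𝕜) := by
      simp only [R, map_sum, map_smul, InnerProductSpace.trace_rankOne]
      refine Finset.sum_congr rfl fun i _ => ?_
      rw [inner_self_eq_norm_sq_to_K, hu.1 i]
      simp
    rw [htr, RCLike.ofReal_re]
    calc ∑ i, r i = ∑ i ∈ Finset.univ.filter (fun i => 0 < s i), max (s i - t) 0 := by
          rw [Finset.sum_subtype (p := fun i => 0 < s i) _ (by simp)]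
      _ ≤ ∑ i, max (s i - t) 0 :=
          Finset.sum_le_sum_of_subset_of_nonneg (Finset.filter_subset _ _)
            fun _ _ _ => le_max_right _ _

/-- `J` is split by the sign of the difference; the nonnegative part is tested against `Z`, the
negative part, reflected by `i ↦ n - 1 - i`, against `Zᗮ`. Equal dimensions make the reflection the
same for `X` and `Y`. -/
theorem sum_abs_cosSq_sub_le {X Y : Submodule 𝕜 H} (Z : Submodule 𝕜 H)
    (hXY : Module.finrank 𝕜 X = Module.finrank 𝕜 Y) {t : ℝ} (ht : 0 ≤ t)
    {J : Finset ℕ} (hJ : ∀ i ∈ J, i < Module.finrank 𝕜 X) :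
    ∑ i ∈ J, |cosSq X Z i - cosSq Y Z i| ≤
      J.card * t + ∑ i : Fin (Module.finrank 𝕜 X), max (√(1 - cosSq X Y i) - t) 0 := by
  classical
  obtain ⟨R, hR, hle, htr⟩ := exists_isPositive_norm_sq_starProjection_le X Y ht
  have hfin : Module.finrank 𝕜 X ≤ Module.finrank 𝕜 H := Submodule.finrank_le X
  set n := Module.finrank 𝕜 X with hn
  let p : ℕ → Prop := fun i => cosSq Y Z i ≤ cosSq X Z i
  have h1 := sum_cosSq_sub_le Z hR ht hle (J := J.filter p)
    fun i hi => (hJ i (Finset.mem_filter.1 hi).1).trans_le hfin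
  have hinj : Set.InjOn (fun i => n - 1 - i) (J.filter fun i => ¬ p i : Finset ℕ) := by
    intro i hi j hj hij
    have hi' := hJ i (Finset.mem_filter.1 hi).1
    have hj' := hJ j (Finset.mem_filter.1 hj).1
    simp only at hij
    omega
  have h2 := sum_cosSq_sub_le Zᗮ hR ht hle
    (J := (J.filter fun i => ¬ p i).image fun i => n - 1 - i) (by
      intro i hi
      obtain ⟨j, hj, rfl⟩ := Finset.mem_image.1 hi
      have hj' := hJ j (Finset.mem_filter.1 hj).1
      omega)
  rw [Finset.sum_image hinj, Finset.card_image_of_injOn hinj] at h2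
  have h3 : ∑ i ∈ J.filter (fun i => ¬ p i), (cosSq X Zᗮ (n - 1 - i) - cosSq Y Zᗮ (n - 1 - i)) =
      ∑ i ∈ J.filter (fun i => ¬ p i), |cosSq X Z i - cosSq Y Z i| := by
    refine Finset.sum_congr rfl fun i hi => ?_
    obtain ⟨hiJ, hip⟩ := Finset.mem_filter.1 hi
    have hi' := hJ i hiJ
    have hlt : n - 1 - i < n := by omega
    have hrev : n - 1 - (n - 1 - i) = i := by omega
    rw [cosSq_orthogonal X Z hlt, cosSq_orthogonal Y Z (hXY ▸ hlt), ← hXY, ← hn, hrev,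
      abs_of_neg (sub_neg.2 (not_le.1 hip))]
    ring
  have h4 : ∑ i ∈ J.filter p, (cosSq X Z i - cosSq Y Z i) =
      ∑ i ∈ J.filter p, |cosSq X Z i - cosSq Y Z i| :=
    Finset.sum_congr rfl fun i hi =>
      (abs_of_nonneg (sub_nonneg.2 (Finset.mem_filter.1 hi).2)).symm
  have h5 : RCLike.re (LinearMap.trace 𝕜 H (R * (Z.starProjection : H →ₗ[𝕜] H))) +
      RCLike.re (LinearMap.trace 𝕜 H (R * (Zᗮ.starProjection : H →ₗ[𝕜] H))) =
      RCLike.re (LinearMap.trace 𝕜 H R) := by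
    rw [← map_add, ← map_add, ← mul_add]
    congr 3
    ext v
    simp [starProjection_orthogonal']
  have h6 : ((J.filter p).card : ℝ) + ((J.filter fun i => ¬ p i).card : ℝ) = J.card := by
    exact_mod_cast Finset.card_filter_add_card_filter_not p
  rw [h4] at h1
  rw [h3] at h2
  rw [← Finset.sum_filter_add_sum_filter_not J p, ← h6]
  linarith

end Submodule

/-! ### Weak majorization by duality. -/

theorem antitone_sortDesc {n : ℕ} (x : Fin n → ℝ) : Antitone (sortDesc x) := fun i j hij => by
  have := Tuple.monotone_sort (fun i => -x i) hij
  simp only [Function.comp_apply, neg_le_neg_iff] at this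
  exact this

/-- Sums of the `k` largest entries are compared through the dual bound
`k * t + ∑ i, max (y i - t) 0`. -/
theorem sum_sortDesc_le_of_forall {N : ℕ} {x y : Fin N → ℝ} (hy : ∀ i, 0 ≤ y i)
    (h : ∀ t, 0 ≤ t → ∀ J : Finset (Fin N), ∑ i ∈ J, x i ≤ J.card * t + ∑ i, max (y i - t) 0)
    {k : ℕ} (hk : k ≤ N) :
    ∑ i : Fin N with i.val < k, sortDesc x i ≤ ∑ i : Fin N with i.val < k, sortDesc y i := by
  rcases Nat.eq_zero_or_pos k with rfl | hk0
  · simp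
  -- The `k`-th largest entry of `y` makes the dual bound equal to the sum of the `k` largest
  -- entries. The hypothesis is applied with `J` the positions of the `k` largest entries of `x`.
  let t := sortDesc y ⟨k - 1, by omega⟩
  have hcard : (Finset.univ.filter fun i : Fin N => i.val < k).card = k := by
    rw [Fin.card_filter_val_lt, min_eq_right hk]
  have h1 := h t (hy _) ((Finset.univ.filter fun i : Fin N => i.val < k).map
    (Tuple.sort fun i => -x i).toEmbedding)
  rw [Finset.sum_map, Finset.card_map, hcard] at h1
  have h2 : ∑ i, max (y i - t) 0 = ∑ i, max (sortDesc y i - t) 0 :=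
    (Equiv.sum_comp (Tuple.sort fun i => -y i) fun i => max (y i - t) 0).symm
  have h3 : ∑ i, max (sortDesc y i - t) 0 =
      ∑ i : Fin N with i.val < k, (sortDesc y i - t) := by
    rw [Finset.sum_filter]
    refine Finset.sum_congr rfl fun i _ => ?_
    split_ifs with hi
    · exact max_eq_left (sub_nonneg.2 (antitone_sortDesc y (Fin.le_def.2 (by simp only; omega))))
    · exact max_eq_right (sub_nonpos.2 (antitone_sortDesc y (Fin.le_def.2 (by simp only; omega))))
  rw [h2, h3, Finset.sum_sub_distrib, Finset.sum_const, hcard, nsmul_eq_mul] at h1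
  simpa [sortDesc] using h1

/-! ### Principal angles and the theorem. -/

namespace Submodule

variable {𝕜 : Type*} [RCLike 𝕜] {H : Type*} [NormedAddCommGroup H] [InnerProductSpace 𝕜 H]
  [FiniteDimensional 𝕜 H]

theorem cos_principalAngles_sq (X Y : Submodule 𝕜 H)
    (i : Fin (min (Module.finrank 𝕜 X) (Module.finrank 𝕜 Y))) :
    Real.cos (principalAngles X Y i) ^ 2 = cosSq X Y i := by
  have h0 := LinearMap.singularValues_nonneg
    ((X.starProjection ∘L Y.starProjection : H →L[𝕜] H) : H →ₗ[𝕜] H) i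
  have h1 := (sq_le_one_iff₀ h0).1 (cosSq_le_one X Y i)
  rw [principalAngles, Real.cos_arccos (by linarith) h1, cosSq]

theorem sin_principalAngles_sq (X Y : Submodule 𝕜 H)
    (i : Fin (min (Module.finrank 𝕜 X) (Module.finrank 𝕜 Y))) :
    Real.sin (principalAngles X Y i) ^ 2 = 1 - cosSq X Y i := by
  rw [Real.sin_sq, cos_principalAngles_sq]

theorem sin_principalAngles (X Y : Submodule 𝕜 H)
    (i : Fin (min (Module.finrank 𝕜 X) (Module.finrank 𝕜 Y))) :
    Real.sin (principalAngles X Y i) = √(1 - cosSq X Y i) := by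
  rw [principalAngles, Real.sin_arccos, cosSq]

end Submodule

open Submodule in
theorem theorem3p3 {𝕜 : Type*} [RCLike 𝕜] {H : Type*} [NormedAddCommGroup H]
    [InnerProductSpace 𝕜 H] [FiniteDimensional 𝕜 H] (X Y Z : Submodule 𝕜 H)
    (hXY : Module.finrank 𝕜 X = Module.finrank 𝕜 Y) :
    (fun i : Fin (min (Module.finrank 𝕜 X) (Module.finrank 𝕜 Z)) =>
        |Real.cos (principalAngles X Z i) ^ 2 -
          Real.cos (principalAngles Y Z (i.cast (by rw [hXY]))) ^ 2|) =
      (fun i : Fin (min (Module.finrank 𝕜 X) (Module.finrank 𝕜 Z)) =>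
        |Real.sin (principalAngles X Z i) ^ 2 -
          Real.sin (principalAngles Y Z (i.cast (by rw [hXY]))) ^ 2|) ∧
    WeaklyMajorizedBy
      (fun i : Fin (min (Module.finrank 𝕜 X) (Module.finrank 𝕜 Z)) =>
        |Real.sin (principalAngles X Z i) ^ 2 -
          Real.sin (principalAngles Y Z (i.cast (by rw [hXY]))) ^ 2|)
      (fun i : Fin (min (Module.finrank 𝕜 X) (Module.finrank 𝕜 Y)) =>
        Real.sin (principalAngles X Y i)) := by
  refine ⟨?_, ?_⟩
  · funext i
    rw [Real.sin_sq, Real.sin_sq, sub_sub_sub_cancel_left, abs_sub_comm]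
  simp only [sin_principalAngles_sq, Fin.val_cast, sub_sub_sub_cancel_left]
  simp only [sin_principalAngles]
  have hn : min (Module.finrank 𝕜 X) (Module.finrank 𝕜 Y) = Module.finrank 𝕜 X := by
    rw [← hXY, min_self]
  have hN : max (min (Module.finrank 𝕜 X) (Module.finrank 𝕜 Z))
      (min (Module.finrank 𝕜 X) (Module.finrank 𝕜 Y)) = Module.finrank 𝕜 X := by
    rw [hn]
    exact max_eq_right (min_le_left _ _)
  intro k hk
  refine sum_sortDesc_le_of_forall (fun i => ?_) (fun t ht J => ?_) hk
  · rw [padZero]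
    split_ifs
    · exact Real.sqrt_nonneg _
    · rfl
  have hsin : ∀ i, padZero (max (min (Module.finrank 𝕜 X) (Module.finrank 𝕜 Z))
      (min (Module.finrank 𝕜 X) (Module.finrank 𝕜 Y)))
      (fun i : Fin (min (Module.finrank 𝕜 X) (Module.finrank 𝕜 Y)) => √(1 - cosSq X Y i)) i =
      √(1 - cosSq X Y i) := fun i => by
    have : (i : ℕ) < min (Module.finrank 𝕜 X) (Module.finrank 𝕜 Y) := by
      have := i.2
      omega
    simp only [padZero, this, dif_pos]
  have hcos : ∀ i, padZero (max (min (Module.finrank 𝕜 X) (Module.finrank 𝕜 Z))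
      (min (Module.finrank 𝕜 X) (Module.finrank 𝕜 Y)))
      (fun i : Fin (min (Module.finrank 𝕜 X) (Module.finrank 𝕜 Z)) =>
        |cosSq Y Z i - cosSq X Z i|) i = |cosSq X Z i - cosSq Y Z i| := fun i => by
    rw [padZero]
    split_ifs with hi
    · exact abs_sub_comm _ _
    -- The common length is `dim X`, so a padded position has index at least `dim Z`; there both
    -- squared cosines vanish, in agreement with the appended zero.
    · have hZ : Module.finrank 𝕜 Z ≤ (i : ℕ) := by
        have := i.2
        omega
      rw [cosSq_comm X Z, cosSq_comm Y Z, cosSq_eq_zero_of_finrank_le Z X hZ,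
        cosSq_eq_zero_of_finrank_le Z Y hZ, sub_self, abs_zero]
  have key := sum_abs_cosSq_sub_le Z hXY ht (J := J.map Fin.valEmbedding) (fun i hi => by
    obtain ⟨j, -, rfl⟩ := Finset.mem_map.1 hi
    exact j.2.trans_eq hN)
  rw [Finset.sum_map, Finset.card_map,
    Fin.sum_univ_eq_sum_range (fun i => max (√(1 - cosSq X Y i) - t) 0)] at key
  simp only [hsin, hcos]
  refine key.trans_eq ?_
  congr 1
  rw [Fin.sum_univ_eq_sum_range (fun i => max (√(1 - cosSq X Y i) - t) 0), hN]
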